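/- Let $A\in\mathbb R^{n\times n}$, $B\in\mathbb R^{n\times p}$, $C\in\mathbb R^{m\times n}$, and let $\|\cdot\|$, $\langle\cdot,\cdot\rangle$ be the Euclidean norm and inner product. For $0<T\le\infty$, an initial state $\xi\in\mathbb R^n$ and a control $u\in L^2((0,T);\mathbb R^p)$, let $x$ be the corresponding continuous solution of $x'=Ax+Bu$, $x(0)=\xi$, that is, $x(t)=\xi+\int_0^t\big(Ax(s)+Bu(s)\big)\,ds$ for all finite $t\in[0,T]$, and set $$V_T(\xi)=\inf_{u\in L^2((0,T);\mathbb R^p)}\int_0^T\big(\|Cx(s)\|^2+\|u(s)\|^2\big)\,ds\in[0,\infty].$$ Assume the finite cost condition: for every $\xi\in\mathbb R^n$ there exists $u\in L^2((0,\infty);\mathbb R^p)$ such that $\int_0^\infty(\|Cx\|^2+\|u\|^2)\,ds<\infty$, where $x'=Ax+Bu$ and $x(0)=\xi$. Then there exists a unique symmetric matrix $P\in\mathbb R^{n\times n}$ such that $$\langle P\xi,\xi\rangle=V_\infty(\xi)<\infty\qquad\text{for all }\xi\in\mathbb R^n,$$ and the following hold. 1. For every $0<T<\infty$ there is a symmetric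 matrix $P_T\in\mathbb R^{n\times n}$ such that $\langle P_T\xi,\xi\rangle=V_T(\xi)<\infty$ for all $\xi\in\mathbb R^n$, and $P_T\to P$ as $T\to+\infty$. 2. For every $\xi\in\mathbb R^n$ the infimum that defines $V_\infty(\xi)$ is attained at a unique control $\widetilde u\in L^2((0,\infty);\mathbb R^p)$, with a unique corresponding solution $\widetilde x$, and $\widetilde u=-B^\top P\widetilde x$ almost everywhere in $[0,\infty)$. 3. $P$ satisfies the algebraic Riccati equation $$A^\top P+PA-PBB^\top P+C^\top C=0.$$ -/

import Mathlib

open MeasureTheory Set Filter Topology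
open scoped Matrix ENNReal

/-- The action `x ↦ M x` of a real `k × l` matrix, as a map between Euclidean spaces. -/
noncomputable def matAct {k l : ℕ} (M : Matrix (Fin k) (Fin l) ℝ) (x : EuclideanSpace ℝ (Fin l)) :
    EuclideanSpace ℝ (Fin k) :=
  WithLp.toLp 2 (M *ᵥ x.ofLp)

/-- `LQ.IsSolution A B I ξ u x`, for a time interval `I` that starts at `0` (`Icc 0 T` or `Ici 0`):
the control `u` is in `L²(I; ℝᵖ)`, and `x` is the continuous solution on `I` of
`x' = A x + B u`, `x(0) = ξ`, in the integrated sense. The values of `u` and `x` at times outside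
`I` are irrelevant. -/
structure LQ.IsSolution {n p : ℕ} (A : Matrix (Fin n) (Fin n) ℝ) (B : Matrix (Fin n) (Fin p) ℝ)
    (I : Set ℝ) (ξ : EuclideanSpace ℝ (Fin n))
    (u : ℝ → EuclideanSpace ℝ (Fin p)) (x : ℝ → EuclideanSpace ℝ (Fin n)) : Prop where
  memLp : MemLp u 2 (volume.restrict I)
  continuousOn : ContinuousOn x I
  eq_integral : ∀ t ∈ I, x t = ξ + ∫ s in (0 : ℝ)..t, (matAct A (x s) + matAct B (u s))

/-- The quadratic cost `∫_I (‖C x‖² + ‖u‖²) ds`, with values in `[0, ∞]`. -/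
noncomputable def LQ.cost {n p m : ℕ} (C : Matrix (Fin m) (Fin n) ℝ) (I : Set ℝ)
    (u : ℝ → EuclideanSpace ℝ (Fin p)) (x : ℝ → EuclideanSpace ℝ (Fin n)) : ℝ≥0∞ :=
  ∫⁻ s in I, ENNReal.ofReal (‖matAct C (x s)‖ ^ 2 + ‖u s‖ ^ 2)

/-- The value function: the infimum, in `[0, ∞]`, of the cost on `I` over all controls
`u ∈ L²(I; ℝᵖ)` and the corresponding solutions `x` with `x(0) = ξ`. -/
noncomputable def LQ.value {n p m : ℕ} (A : Matrix (Fin n) (Fin n) ℝ)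
    (B : Matrix (Fin n) (Fin p) ℝ) (C : Matrix (Fin m) (Fin n) ℝ) (I : Set ℝ)
    (ξ : EuclideanSpace ℝ (Fin n)) : ℝ≥0∞ :=
  ⨅ (u : ℝ → EuclideanSpace ℝ (Fin p)) (x : ℝ → EuclideanSpace ℝ (Fin n))
    (_ : LQ.IsSolution A B I ξ u x), LQ.cost C I u x

/-- `(x, u)` is an optimal solution of the problem on `I` with initial state `ξ`. -/
structure LQ.IsOptimal {n p m : ℕ} (A : Matrix (Fin n) (Fin n) ℝ) (B : Matrix (Fin n) (Fin p) ℝ)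
    (C : Matrix (Fin m) (Fin n) ℝ) (I : Set ℝ) (ξ : EuclideanSpace ℝ (Fin n))
    (u : ℝ → EuclideanSpace ℝ (Fin p)) (x : ℝ → EuclideanSpace ℝ (Fin n)) : Prop where
  isSolution : LQ.IsSolution A B I ξ u x
  cost_eq : LQ.cost C I u x = LQ.value A B C I ξ

/-- `P` is a symmetric matrix, and the value function on `I` is finite and equal to the quadratic
form `⟨P ξ, ξ⟩`. -/
structure LQ.IsValueMatrix {n p m : ℕ} (A : Matrix (Fin n) (Fin n) ℝ)
    (B : Matrix (Fin n) (Fin p) ℝ) (C : Matrix (Fin m) (Fin n) ℝ) (I : Set ℝ)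
    (P : Matrix (Fin n) (Fin n) ℝ) : Prop where
  isSymm : P.IsSymm
  value_ne_top : ∀ ξ : EuclideanSpace ℝ (Fin n), LQ.value A B C I ξ ≠ ∞
  inner_eq : ∀ ξ : EuclideanSpace ℝ (Fin n),
    inner ℝ (matAct P ξ) ξ = (LQ.value A B C I ξ).toReal

/-- The finite cost condition for the triple `(A, B, C)`. -/
def LQ.FiniteCost {n p m : ℕ} (A : Matrix (Fin n) (Fin n) ℝ) (B : Matrix (Fin n) (Fin p) ℝ)
    (C : Matrix (Fin m) (Fin n) ℝ) : Prop :=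
  ∀ ξ : EuclideanSpace ℝ (Fin n), ∃ (u : ℝ → EuclideanSpace ℝ (Fin p))
    (x : ℝ → EuclideanSpace ℝ (Fin n)),
    LQ.IsSolution A B (Ici 0) ξ u x ∧ LQ.cost C (Ici 0) u x < ∞

/-! The problem is turned into one of least norm in a Hilbert space. A pair (control, output) is a
vector of `L²(0,∞)` whose squared norm is the cost, and the pairs (initial state, signal) compatible
with the dynamics on `I` form a linear subspace, `outputFibre`. The value at `ξ` is the least
squared norm in the fibre over `ξ`. The fibres are closed (`isClosed_outputFibre`) and nonempty by
the finite cost condition, so the minimizer exists, is unique and depends linearly on `ξ`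
(`exists_isMinSection`). The value is then a quadratic form, represented by a Gram matrix. Signals
are left free outside `I`, so the subspaces for `[0,T]` decrease in one fixed space and their
intersection is the one for `[0,∞)`; least-norm elements converge (`IsMinSection.tendsto`), which
gives `P_T → P`.

The feedback law and the Riccati equation come from dynamic programming. Completing the square along
a solution (`LQ.IsSolution.integral_excess`) expresses the cost on `[0,h]` plus the variation of
`⟨Px,x⟩` as the integral of `⟨R x,x⟩ + ‖u + BᵀPx‖²`, where `R` is the Riccati residual. This
integral is nonnegative for every solution; testing with short times gives `R ≥ 0`. It is
nonpositive for an optimal solution, so both terms vanish almost everywhere along it. The second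
gives the feedback, and the first, by continuity at time `0`, gives `⟨Rξ,ξ⟩ = 0` for every `ξ`. -/

/-! ### Product rule for primitives of integrable functions. -/

section Leibniz

variable {E F G : Type*} [NormedAddCommGroup E] [NormedSpace ℝ E] [NormedAddCommGroup F]
  [NormedSpace ℝ F] [NormedAddCommGroup G] [NormedSpace ℝ G]

/-- Fubini on the square `(0,t]²`, cut along the diagonal: the two triangles give the two iterated
integrals on the right. -/
theorem integral_bilin_integral [CompleteSpace E] [CompleteSpace F] [CompleteSpace G]
    (L : E →L[ℝ] F →L[ℝ] G) {f : ℝ → E} {g : ℝ → F} {t : ℝ}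
    (hf : IntegrableOn f (Ioc 0 t)) (hg : IntegrableOn g (Ioc 0 t)) :
    Integrable (fun s => L (f s) (∫ r in Ioc 0 s, g r)) (volume.restrict (Ioc 0 t)) ∧
    Integrable (fun s => L (∫ r in Ioc 0 s, f r) (g s)) (volume.restrict (Ioc 0 t)) ∧
    L (∫ s in Ioc 0 t, f s) (∫ s in Ioc 0 t, g s) =
      (∫ s in Ioc 0 t, L (f s) (∫ r in Ioc 0 s, g r)) +
        ∫ s in Ioc 0 t, L (∫ r in Ioc 0 s, f r) (g s) := by
  set μ := volume.restrict (Ioc (0 : ℝ) t) with hμ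
  have hint : Integrable (fun z : ℝ × ℝ => L (f z.1) (g z.2)) (μ.prod μ) :=
    hf.op_fst_snd (op := fun x y => L x y) (by fun_prop) ⟨‖L‖, L.le_opNorm₂⟩ hg
  set D : Set (ℝ × ℝ) := {z | z.2 ≤ z.1} with hD
  have hDm : MeasurableSet D := measurableSet_le measurable_snd measurable_fst
  have hmem : ∀ᵐ s ∂μ, s ∈ Ioc 0 t := ae_restrict_mem measurableSet_Ioc
  have h1 : ∀ᵐ s ∂μ, ∫ r, D.indicator (fun z : ℝ × ℝ => L (f z.1) (g z.2)) (s, r) ∂μ =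
      L (f s) (∫ r in Ioc 0 s, g r) := by
    filter_upwards [hmem] with s hs
    have : (fun r => D.indicator (fun z : ℝ × ℝ => L (f z.1) (g z.2)) (s, r)) =
        (Iic s).indicator (fun r => L (f s) (g r)) := by
      ext r; simp [D, indicator]
    rw [this, integral_indicator measurableSet_Iic, hμ, Measure.restrict_restrict measurableSet_Iic]
    have h2 : Iic s ∩ Ioc 0 t = Ioc 0 s := by
      ext r; simp only [mem_inter_iff, mem_Iic, mem_Ioc] at hs ⊢
      constructor
      · rintro ⟨a, b, c⟩; exact ⟨b, a⟩
      · rintro ⟨a, b⟩; exact ⟨b, a, b.trans hs.2⟩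
    rw [h2]
    exact (L (f s)).integral_comp_comm (hg.mono_set (Ioc_subset_Ioc_right hs.2))
  have h2 : ∀ᵐ r ∂μ, ∫ s, Dᶜ.indicator (fun z : ℝ × ℝ => L (f z.1) (g z.2)) (s, r) ∂μ =
      L (∫ s in Ioc 0 r, f s) (g r) := by
    filter_upwards [hmem] with r hr
    have : (fun s => Dᶜ.indicator (fun z : ℝ × ℝ => L (f z.1) (g z.2)) (s, r)) =
        (Iio r).indicator (fun s => L.flip (g r) (f s)) := by
      ext s; simp [D, indicator]
    rw [this, integral_indicator measurableSet_Iio, hμ, Measure.restrict_restrict measurableSet_Iio]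
    have h2 : Iio r ∩ Ioc 0 t = Ioo 0 r := by
      ext s; simp only [mem_inter_iff, mem_Iio, mem_Ioc, mem_Ioo] at hr ⊢
      constructor
      · rintro ⟨a, b, c⟩; exact ⟨b, a⟩
      · rintro ⟨a, b⟩; exact ⟨b, a, b.le.trans hr.2⟩
    rw [h2, ← integral_Ioc_eq_integral_Ioo]
    exact (L.flip (g r)).integral_comp_comm (hf.mono_set (Ioc_subset_Ioc_right hr.2))
  have i1 := hint.indicator hDm
  have i2 := hint.indicator hDm.compl
  refine ⟨i1.integral_prod_left.congr h1, i2.integral_prod_right.congr h2, ?_⟩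
  rw [← integral_congr_ae h1, ← integral_congr_ae h2, ← integral_prod _ i1,
    ← integral_prod_symm _ i2, integral_indicator hDm, integral_indicator hDm.compl,
    integral_add_compl hDm hint, integral_prod _ hint]
  have h3 : ∀ s, ∫ r, L (f s) (g r) ∂μ = L (f s) (∫ r, g r ∂μ) :=
    fun s => (L (f s)).integral_comp_comm hg
  simp_rw [h3]
  exact ((L.flip (∫ r, g r ∂μ)).integral_comp_comm hf).symm

/-- The Leibniz rule, in integrated form, for a continuous bilinear map applied to two
primitives of integrable functions. -/
theorem bilin_primitive [CompleteSpace E] [CompleteSpace F] [CompleteSpace G]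
    (L : E →L[ℝ] F →L[ℝ] G) {f : ℝ → E} {g : ℝ → F} {x : ℝ → E} {y : ℝ → F} {t : ℝ} (ht : 0 ≤ t)
    (hf : IntegrableOn f (Ioc 0 t)) (hg : IntegrableOn g (Ioc 0 t)) {x0 : E} {y0 : F}
    (hx : ∀ s ∈ Icc 0 t, x s = x0 + ∫ r in (0 : ℝ)..s, f r)
    (hy : ∀ s ∈ Icc 0 t, y s = y0 + ∫ r in (0 : ℝ)..s, g r) :
    IntervalIntegrable (fun s => L (f s) (y s) + L (x s) (g s)) volume 0 t ∧
    L (x t) (y t) = L x0 y0 + ∫ s in (0 : ℝ)..t, (L (f s) (y s) + L (x s) (g s)) := by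
  obtain ⟨i1, i2, h⟩ := integral_bilin_integral L hf hg
  have e : ∀ s ∈ Ioc 0 t, L (f s) (y s) + L (x s) (g s) =
      (L.flip y0 (f s) + L x0 (g s)) +
        (L (f s) (∫ r in Ioc 0 s, g r) + L (∫ r in Ioc 0 s, f r) (g s)) := by
    intro s hs
    rw [hx s (Ioc_subset_Icc_self hs), hy s (Ioc_subset_Icc_self hs),
      intervalIntegral.integral_of_le hs.1.le, intervalIntegral.integral_of_le hs.1.le]
    simp only [map_add, add_apply, ContinuousLinearMap.flip_apply]
    abel
  have j1 : IntegrableOn (fun s => L.flip y0 (f s)) (Ioc 0 t) :=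
    ContinuousLinearMap.integrable_comp _ hf
  have j2 : IntegrableOn (fun s => L x0 (g s)) (Ioc 0 t) :=
    ContinuousLinearMap.integrable_comp _ hg
  constructor
  · rw [intervalIntegrable_iff_integrableOn_Ioc_of_le ht]
    exact ((j1.add j2).add (i1.add i2)).congr_fun (fun s hs => (e s hs).symm) measurableSet_Ioc
  · rw [intervalIntegral.integral_of_le ht, setIntegral_congr_fun measurableSet_Ioc e,
      integral_add (μ := volume.restrict (Ioc 0 t))
        (f := fun s => L.flip y0 (f s) + L x0 (g s))
        (g := fun s => L (f s) (∫ r in Ioc 0 s, g r) + L (∫ r in Ioc 0 s, f r) (g s)) (j1.add j2) (i1.add i2),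
      integral_add i1 i2, integral_add j1 j2, ← h,
      (L.flip y0).integral_comp_comm hf, (L x0).integral_comp_comm hg,
      hx t ⟨ht, le_rfl⟩, hy t ⟨ht, le_rfl⟩, intervalIntegral.integral_of_le ht,
      intervalIntegral.integral_of_le ht]
    simp only [map_add, add_apply, ContinuousLinearMap.flip_apply]
    abel

end Leibniz

/-! ### Linear control systems and variation of constants. -/

section Trajectory

variable {E : Type*} [NormedAddCommGroup E] [NormedSpace ℝ E]

/-- Variation of constants: the solution of `x' = A x + b`, `x 0 = ξ`. -/
noncomputable def traj (A : E →L[ℝ] E) (ξ : E) (b : ℝ → E) (t : ℝ) : E :=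
  NormedSpace.exp (t • A) (ξ + ∫ s in (0 : ℝ)..t, NormedSpace.exp ((-s) • A) (b s))

theorem continuous_exp_smul [CompleteSpace E] (A : E →L[ℝ] E) :
    Continuous fun t : ℝ => NormedSpace.exp (t • A) :=
  (differentiable_exp_smul_const ℝ A).continuous

theorem hasDerivAt_exp_neg_smul [CompleteSpace E] (A : E →L[ℝ] E) (t : ℝ) :
    HasDerivAt (fun u : ℝ => NormedSpace.exp ((-u) • A)) (-(NormedSpace.exp ((-t) • A) * A)) t := by
  have := (hasDerivAt_exp_smul_const (𝕂 := ℝ) A (-t)).scomp t (hasDerivAt_neg t)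
  simpa [Function.comp_def] using this

theorem exp_smul_exp_neg [CompleteSpace E] (A : E →L[ℝ] E) (t : ℝ) :
    NormedSpace.exp (t • A) * NormedSpace.exp ((-t) • A) = 1 := by
  let := NormedAlgebra.restrictScalars ℚ ℝ (E →L[ℝ] E)
  rw [← NormedSpace.exp_add_of_commute]
  · simp
  · exact ((Commute.refl A).smul_left t).smul_right (-t)

theorem integrableOn_exp_neg [CompleteSpace E] (A : E →L[ℝ] E) {b : ℝ → E} {t : ℝ}
    (hb : IntegrableOn b (Ioc 0 t)) :
    IntegrableOn (fun s => NormedSpace.exp ((-s) • A) (b s)) (Ioc 0 t) := by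
  have hc : Continuous fun s : ℝ => NormedSpace.exp ((-s) • A) :=
    (continuous_exp_smul A).comp continuous_neg
  obtain ⟨K, hK⟩ := isCompact_Icc.exists_bound_of_continuousOn (s := Icc 0 t) hc.continuousOn
  refine Integrable.mono' (hb.norm.const_mul K) ?_ ?_
  · exact (ContinuousLinearMap.id ℝ (E →L[ℝ] E)).aestronglyMeasurable_comp₂
      hc.aestronglyMeasurable hb.1
  · filter_upwards [ae_restrict_mem measurableSet_Ioc] with s hs
    exact (ContinuousLinearMap.le_opNorm _ _).trans
      (mul_le_mul_of_nonneg_right (hK s (Ioc_subset_Icc_self hs)) (norm_nonneg _))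

/-- Every integrated solution on `[0, t]` is given by variation of constants. -/
theorem eq_traj [CompleteSpace E] (A : E →L[ℝ] E) {ξ : E} {b x : ℝ → E} {t : ℝ} (ht : 0 ≤ t)
    (hb : IntegrableOn b (Ioc 0 t)) (hxc : ContinuousOn x (Icc 0 t))
    (hx : ∀ s ∈ Icc 0 t, x s = ξ + ∫ r in (0 : ℝ)..s, (A (x r) + b r)) :
    x t = traj A ξ b t := by
  have hAx : IntegrableOn (fun s => A (x s)) (Ioc 0 t) :=
    ((A.continuous.comp_continuousOn hxc).integrableOn_Icc).mono_set Ioc_subset_Icc_self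
  have hc : Continuous fun s : ℝ => -(NormedSpace.exp ((-s) • A) * A) :=
    (((continuous_exp_smul A).comp continuous_neg).mul continuous_const).neg
  have hM : ∀ s ∈ Icc 0 t, NormedSpace.exp ((-s) • A) =
      1 + ∫ r in (0 : ℝ)..s, -(NormedSpace.exp ((-r) • A) * A) := by
    intro s _
    rw [intervalIntegral.integral_eq_sub_of_hasDerivAt
      (fun r _ => hasDerivAt_exp_neg_smul A r) (hc.intervalIntegrable _ _)]
    simp
  -- Product rule for `e^{-sA} x(s)`: the terms in `A x` cancel and only `e^{-sA} b(s)` is left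
  -- under the integral.
  have key := (bilin_primitive (ContinuousLinearMap.id ℝ (E →L[ℝ] E)) ht
    (hc.integrableOn_Icc.mono_set Ioc_subset_Icc_self) (hAx.add hb) hM hx).2
  have e : ∀ s, (ContinuousLinearMap.id ℝ (E →L[ℝ] E)) (-(NormedSpace.exp ((-s) • A) * A)) (x s) +
      (ContinuousLinearMap.id ℝ (E →L[ℝ] E)) (NormedSpace.exp ((-s) • A)) (A (x s) + b s) =
      NormedSpace.exp ((-s) • A) (b s) := by
    intro s; simp
  simp only [Pi.add_apply, e] at key
  simp only [ContinuousLinearMap.id_apply, one_apply_eq_self] at key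
  rw [traj, ← key, ← mul_apply_eq_comp, exp_smul_exp_neg,
    one_apply_eq_self]

theorem continuousOn_traj [CompleteSpace E] (A : E →L[ℝ] E) (ξ : E) {b : ℝ → E} {T : ℝ}
    (hb : IntegrableOn b (Ioc 0 T)) : ContinuousOn (traj A ξ b) (Icc 0 T) := by
  rcases lt_or_ge T 0 with hT | hT
  · simp [Icc_eq_empty_of_lt hT]
  have h := intervalIntegral.continuousOn_primitive_interval (a := 0) (b := T) (μ := volume)
    (f := fun s => NormedSpace.exp ((-s) • A) (b s)) (by
      rw [uIcc_of_le hT, integrableOn_Icc_iff_integrableOn_Ioc]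
      exact integrableOn_exp_neg A hb)
  rw [uIcc_of_le hT] at h
  exact (continuous_exp_smul A).continuousOn.clm_apply (continuousOn_const.add h)

/-- Product rule for `e^{sA}` applied to `ξ + ∫ e^{-rA} b`. With merely integrable `b` there is no
pointwise derivative to use. -/
theorem traj_eq_integral [CompleteSpace E] (A : E →L[ℝ] E) (ξ : E) {b : ℝ → E} {t : ℝ} (ht : 0 ≤ t)
    (hb : IntegrableOn b (Ioc 0 t)) :
    traj A ξ b t = ξ + ∫ s in (0 : ℝ)..t, (A (traj A ξ b s) + b s) := by
  have hc : Continuous fun s : ℝ => A * NormedSpace.exp (s • A) :=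
    continuous_const.mul (continuous_exp_smul A)
  have hM : ∀ s ∈ Icc 0 t, NormedSpace.exp (s • A) =
      1 + ∫ r in (0 : ℝ)..s, A * NormedSpace.exp (r • A) := by
    intro s _
    rw [intervalIntegral.integral_eq_sub_of_hasDerivAt
      (fun r _ => hasDerivAt_exp_smul_const' (𝕂 := ℝ) A r) (hc.intervalIntegrable _ _)]
    simp
  have key := (bilin_primitive (ContinuousLinearMap.id ℝ (E →L[ℝ] E)) ht
    (hc.integrableOn_Icc.mono_set Ioc_subset_Icc_self) (integrableOn_exp_neg A hb) hM
    (fun s _ => rfl) (y0 := ξ)).2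
  simp only [ContinuousLinearMap.id_apply, one_apply_eq_self] at key
  rw [traj, key]
  congr 2
  ext s
  have := DFunLike.congr_fun (exp_smul_exp_neg A s) (b s)
  rw [mul_apply_eq_comp, one_apply_eq_self] at this
  rw [this, mul_apply_eq_comp, traj]

theorem traj_congr (A : E →L[ℝ] E) (ξ : E) {b b' : ℝ → E} {t : ℝ} (ht : 0 ≤ t)
    (h : b =ᵐ[volume.restrict (Ioc 0 t)] b') : traj A ξ b t = traj A ξ b' t := by
  unfold traj
  rw [intervalIntegral.integral_of_le ht, intervalIntegral.integral_of_le ht]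
  congr 2
  refine integral_congr_ae ?_
  filter_upwards [h] with s hs
  rw [hs]

theorem traj_add [CompleteSpace E] (A : E →L[ℝ] E) (ξ η : E) {b b' : ℝ → E} {t : ℝ} (ht : 0 ≤ t)
    (hb : IntegrableOn b (Ioc 0 t)) (hb' : IntegrableOn b' (Ioc 0 t)) :
    traj A (ξ + η) (fun s => b s + b' s) t = traj A ξ b t + traj A η b' t := by
  unfold traj
  simp only [intervalIntegral.integral_of_le ht, map_add]
  rw [integral_add (integrableOn_exp_neg A hb) (integrableOn_exp_neg A hb'), map_add]
  abel

theorem traj_smul (A : E →L[ℝ] E) (c : ℝ) (ξ : E) (b : ℝ → E) (t : ℝ) :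
    traj A (c • ξ) (fun s => c • b s) t = c • traj A ξ b t := by
  unfold traj
  simp only [map_smul, intervalIntegral.integral_smul, ← smul_add]

end Trajectory

/-! ### Least-norm selections of a linear relation in a Hilbert space. -/

section MinimalSection

variable {E H : Type*} [AddCommGroup E] [Module ℝ E] [NormedAddCommGroup H]
  [InnerProductSpace ℝ H]

/-- `F` selects linearly the element of least norm in each fibre of `W`. -/
structure IsMinSection (W : Submodule ℝ (E × H)) (F : E →ₗ[ℝ] H) : Prop where
  mem : ∀ ξ, (ξ, F ξ) ∈ W
  norm_sq : ∀ ξ g, (ξ, g) ∈ W → ‖g‖ ^ 2 = ‖F ξ‖ ^ 2 + ‖g - F ξ‖ ^ 2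

/-- All fibres are translates of the fibre `K` over `0`. An algebraic linear section `G`, minus its
orthogonal projection onto `K`, is linear and orthogonal to `K`; `norm_sq` is then Pythagoras. Only
`K` has to be closed. -/
theorem exists_isMinSection [CompleteSpace H] (W : Submodule ℝ (E × H))
    (hcl : IsClosed {g : H | ((0 : E), g) ∈ W}) (hne : ∀ ξ, ∃ g, (ξ, g) ∈ W) :
    ∃ F : E →ₗ[ℝ] H, IsMinSection W F := by
  let K : Submodule ℝ H := W.comap (LinearMap.inr ℝ E H)
  have hK : ∀ g, g ∈ K ↔ ((0 : E), g) ∈ W := fun g => Iff.rfl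
  have : CompleteSpace K := IsClosed.completeSpace_coe (hs := hcl)
  let π : W →ₗ[ℝ] E := LinearMap.fst ℝ E H ∘ₗ W.subtype
  have hπ : LinearMap.range π = ⊤ := by
    refine LinearMap.range_eq_top.2 fun ξ => ?_
    obtain ⟨g, hg⟩ := hne ξ
    exact ⟨⟨(ξ, g), hg⟩, rfl⟩
  obtain ⟨σ, hσ⟩ := π.exists_rightInverse_of_surjective hπ
  let G : E →ₗ[ℝ] H := LinearMap.snd ℝ E H ∘ₗ W.subtype ∘ₗ σ
  have hG : ∀ ξ, (ξ, G ξ) ∈ W := fun ξ => by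
    have h1 : ((σ ξ : E × H)).1 = ξ := LinearMap.congr_fun hσ ξ
    have : (σ ξ : E × H) = (ξ, G ξ) := Prod.ext h1 rfl
    rw [← this]; exact (σ ξ).2
  let F : E →ₗ[ℝ] H := G - K.starProjection.toLinearMap ∘ₗ G
  have hF : ∀ ξ, F ξ = G ξ - K.starProjection (G ξ) := fun ξ => rfl
  have hmem : ∀ ξ, (ξ, F ξ) ∈ W := fun ξ => by
    have h2 := W.sub_mem (hG ξ) ((hK _).1 (K.starProjection_apply_mem (G ξ)))
    simpa [hF] using h2
  refine ⟨F, hmem, fun ξ g hg => ?_⟩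
  have h3 : g - F ξ ∈ K := by
    have := W.sub_mem hg (hmem ξ)
    rw [hK]; simpa using this
  have h4 : inner ℝ (F ξ) (g - F ξ) = 0 := by
    rw [hF ξ, real_inner_comm]
    exact Submodule.sub_starProjection_mem_orthogonal (G ξ) _ h3
  have h5 := norm_add_sq_real (F ξ) (g - F ξ)
  rw [h4, add_sub_cancel] at h5
  linarith

theorem IsMinSection.norm_le {W : Submodule ℝ (E × H)} {F : E →ₗ[ℝ] H} (hF : IsMinSection W F)
    {ξ : E} {g : H} (hg : (ξ, g) ∈ W) : ‖F ξ‖ ^ 2 ≤ ‖g‖ ^ 2 := by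
  have := hF.norm_sq ξ g hg
  have := sq_nonneg ‖g - F ξ‖
  linarith

theorem IsMinSection.eq_of_norm_le {W : Submodule ℝ (E × H)} {F : E →ₗ[ℝ] H}
    (hF : IsMinSection W F) {ξ : E} {g : H} (hg : (ξ, g) ∈ W) (h : ‖g‖ ^ 2 ≤ ‖F ξ‖ ^ 2) :
    g = F ξ := by
  have h1 := hF.norm_sq ξ g hg
  have h2 : ‖g - F ξ‖ ^ 2 = 0 := le_antisymm (by linarith) (sq_nonneg _)
  exact sub_eq_zero.1 (norm_eq_zero.1 (pow_eq_zero_iff two_ne_zero |>.1 h2))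

/-- For a decreasing family of closed subspaces, the sections of least norm converge to
the section of least norm of the intersection. -/
theorem IsMinSection.tendsto [CompleteSpace H] {W : ℝ → Submodule ℝ (E × H)}
    {W' : Submodule ℝ (E × H)} {F : ℝ → E →ₗ[ℝ] H} {F' : E →ₗ[ℝ] H} (hW : Antitone W)
    (hF : ∀ T, IsMinSection (W T) (F T)) (hF' : IsMinSection W' F') (hle : ∀ T, W' ≤ W T)
    (hinf : ∀ z, (∀ T, z ∈ W T) → z ∈ W')
    (hcl : ∀ T ξ, IsClosed {g : H | (ξ, g) ∈ W T}) (ξ : E) :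
    Tendsto (fun T => F T ξ) atTop (𝓝 (F' ξ)) := by
  have hmono : Monotone fun T => ‖F T ξ‖ ^ 2 := fun S T hST =>
    (hF S).norm_le (hW hST ((hF T).mem ξ))
  have hbd : ∀ T, ‖F T ξ‖ ^ 2 ≤ ‖F' ξ‖ ^ 2 := fun T => (hF T).norm_le (hle T (hF'.mem ξ))
  have hlim := tendsto_atTop_ciSup hmono ⟨_, by rintro _ ⟨T, rfl⟩; exact hbd T⟩
  have hcau : CauchySeq fun T => F T ξ := by
    rw [Metric.cauchySeq_iff']
    intro ε hε
    obtain ⟨N, hN⟩ := Metric.cauchySeq_iff'.1 hlim.cauchySeq (ε ^ 2) (by positivity)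
    refine ⟨N, fun T hT => ?_⟩
    have h1 := hN T hT
    rw [Real.dist_eq] at h1
    -- By Pythagoras, `‖F T ξ - F N ξ‖²` is the increment of the bounded monotone function `T ↦ ‖F T
    -- ξ‖²`, so the family is Cauchy.
    have h2 := (hF N).norm_sq ξ _ (hW hT ((hF T).mem ξ))
    rw [dist_eq_norm]
    exact lt_of_pow_lt_pow_left₀ 2 hε.le (by have := le_abs_self (‖F T ξ‖ ^ 2 - ‖F N ξ‖ ^ 2); linarith)
  obtain ⟨g, hg⟩ := cauchySeq_tendsto_of_complete hcau
  have hgm : (ξ, g) ∈ W' := hinf _ fun S => by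
    refine (hcl S ξ).mem_of_tendsto hg ?_
    filter_upwards [eventually_ge_atTop S] with T hT using hW hT ((hF T).mem ξ)
  have hgn : ‖g‖ ^ 2 ≤ ‖F' ξ‖ ^ 2 :=
    le_of_tendsto (hg.norm.pow 2) (Eventually.of_forall hbd)
  rwa [← hF'.eq_of_norm_le hgm hgn]

end MinimalSection

/-! ### The closed relation between initial states and (control, output) signals. -/

section Fibre

variable {E U Y : Type*} [NormedAddCommGroup E] [NormedSpace ℝ E]
  [NormedAddCommGroup U] [InnerProductSpace ℝ U] [NormedAddCommGroup Y] [InnerProductSpace ℝ Y]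

theorem integrableOn_Ioc_of_memLp_two {F : Type*} [NormedAddCommGroup F] {g : ℝ → F} {t : ℝ} {I : Set ℝ}
    (hI : Ioc 0 t ⊆ I) (hg : MemLp g 2 (volume.restrict I)) : IntegrableOn g (Ioc 0 t) :=
  (hg.mono_measure (Measure.restrict_mono hI le_rfl)).integrable (by norm_num)

theorem integrableOn_forcing (B : U →L[ℝ] E)
    (g : Lp (WithLp 2 (U × Y)) 2 (volume.restrict (Ici (0 : ℝ)))) (t : ℝ) :
    IntegrableOn (fun r => B (g r).fst) (Ioc 0 t) :=
  (B.comp (WithLp.fstL 2 ℝ U Y)).integrable_comp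
    (integrableOn_Ioc_of_memLp_two (fun _ hs => hs.1.le) (Lp.memLp g))

variable [CompleteSpace E]

/-- The pairs of an initial state and of a function `(u, y)` such that `y` is on `I` the output
`C x` of the trajectory `x` with control `u`. -/
noncomputable def outputFibre (A : E →L[ℝ] E) (B : U →L[ℝ] E) (C : E →L[ℝ] Y) (I : Set ℝ) :
    Submodule ℝ (E × Lp (WithLp 2 (U × Y)) 2 (volume.restrict (Ici (0 : ℝ)))) where
  carrier := {z | ∀ᵐ s ∂(volume.restrict (Ici (0 : ℝ))), s ∈ I →
    (z.2 s).snd = C (traj A z.1 (fun r => B (z.2 r).fst) s)}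
  add_mem' := by
    rintro ⟨ξ, g⟩ ⟨η, h⟩ hg hh
    have hadd := Lp.coeFn_add g h
    filter_upwards [hg, hh, hadd, ae_restrict_mem measurableSet_Ici] with s h1 h2 h3 h4 h5
    have h6 : traj A (ξ + η) (fun r => B ((g + h : Lp _ 2 _) r).fst) s =
        traj A (ξ + η) (fun r => B (g r).fst + B (h r).fst) s := by
      refine traj_congr A _ h4 ?_
      have := ae_restrict_of_ae_restrict_of_subset
        (show Ioc 0 s ⊆ Ici 0 from fun _ hs => hs.1.le) hadd
      filter_upwards [this] with r hr
      rw [hr]; simp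
    have e1 := h1 h5
    have e2 := h2 h5
    simp only [Prod.mk_add_mk] at e1 e2 ⊢
    rw [h6, traj_add A ξ η h4 (integrableOn_forcing B g s) (integrableOn_forcing B h s), h3,
      map_add, ← e1, ← e2]
    rfl
  zero_mem' := by
    have h0 := Lp.coeFn_zero (WithLp 2 (U × Y)) 2 (volume.restrict (Ici (0 : ℝ)))
    filter_upwards [h0, ae_restrict_mem measurableSet_Ici] with s h1 h4 _
    have h6 : traj A 0 (fun r => B ((0 : Lp (WithLp 2 (U × Y)) 2 (volume.restrict (Ici (0 : ℝ)))) r).fst) s =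
        traj A 0 (fun _ => 0) s := by
      refine traj_congr A _ h4 ?_
      have := ae_restrict_of_ae_restrict_of_subset
        (show Ioc 0 s ⊆ Ici 0 from fun _ hs => hs.1.le) h0
      filter_upwards [this] with r hr
      rw [hr]; simp
    simp only [Prod.fst_zero, Prod.snd_zero]
    rw [h6, h1]
    simp [traj]
  smul_mem' := by
    rintro c ⟨ξ, g⟩ hg
    have hs := Lp.coeFn_smul c g
    filter_upwards [hg, hs, ae_restrict_mem measurableSet_Ici] with s h1 h3 h4 h5
    have h6 : traj A (c • ξ) (fun r => B ((c • g : Lp _ 2 _) r).fst) s =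
        traj A (c • ξ) (fun r => c • B (g r).fst) s := by
      refine traj_congr A _ h4 ?_
      have := ae_restrict_of_ae_restrict_of_subset
        (show Ioc 0 s ⊆ Ici 0 from fun _ hs => hs.1.le) hs
      filter_upwards [this] with r hr
      rw [hr]; simp
    have e1 := h1 h5
    simp only [Prod.smul_mk] at e1 ⊢
    rw [h6, traj_smul, h3, map_smul, ← e1]
    rfl

theorem mem_outputFibre {A : E →L[ℝ] E} {B : U →L[ℝ] E} {C : E →L[ℝ] Y} {I : Set ℝ} {ξ : E}
    {g : Lp (WithLp 2 (U × Y)) 2 (volume.restrict (Ici (0 : ℝ)))} :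
    (ξ, g) ∈ outputFibre A B C I ↔ ∀ᵐ s ∂(volume.restrict (Ici (0 : ℝ))), s ∈ I →
      (g s).snd = C (traj A ξ (fun r => B (g r).fst) s) := Iff.rfl

/-- On the bounded interval `(0,t]` the `L¹` norm is controlled by the `L²` norm (Hölder), and
`e^{-sA}` is bounded there. -/
theorem tendsto_traj (A : E →L[ℝ] E) (B : U →L[ℝ] E) (ξ : E) {t : ℝ} (ht : 0 ≤ t)
    {f : ℕ → Lp (WithLp 2 (U × Y)) 2 (volume.restrict (Ici (0 : ℝ)))}
    {g : Lp (WithLp 2 (U × Y)) 2 (volume.restrict (Ici (0 : ℝ)))}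
    (hf : Tendsto f atTop (𝓝 g)) :
    Tendsto (fun k => traj A ξ (fun r => B (f k r).fst) t) atTop
      (𝓝 (traj A ξ (fun r => B (g r).fst) t)) := by
  unfold traj
  refine ((NormedSpace.exp (t • A)).continuous.tendsto _).comp (tendsto_const_nhds.add ?_)
  simp only [intervalIntegral.integral_of_le ht]
  have hint := fun h : Lp (WithLp 2 (U × Y)) 2 (volume.restrict (Ici (0 : ℝ))) =>
    integrableOn_exp_neg A (integrableOn_forcing B h t)
  refine tendsto_integral_of_L1' _ (hint g).1 (Eventually.of_forall fun k => hint (f k)) ?_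
  have hc : Continuous fun s : ℝ => NormedSpace.exp ((-s) • A) :=
    (continuous_exp_smul A).comp continuous_neg
  obtain ⟨K, hK⟩ := isCompact_Icc.exists_bound_of_continuousOn (s := Icc 0 t) hc.continuousOn
  have hK0 : 0 ≤ K := (norm_nonneg _).trans (hK 0 ⟨le_rfl, ht⟩)
  set ν := volume.restrict (Ioc (0 : ℝ) t)
  have hν : ν ≤ volume.restrict (Ici 0) :=
    Measure.restrict_mono (fun _ hs => hs.1.le) le_rfl
  set L : WithLp 2 (U × Y) →L[ℝ] E := B.comp (WithLp.fstL 2 ℝ U Y)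
  have hbound : ∀ k, eLpNorm ((fun s => NormedSpace.exp ((-s) • A) (B (f k s).fst)) -
      fun s => NormedSpace.exp ((-s) • A) (B (g s).fst)) 1 ν ≤
      ENNReal.ofReal (K * ‖L‖) * (eLpNorm (⇑(f k) - ⇑g) 2 (volume.restrict (Ici 0)) *
        ν univ ^ (1 / (1 : ℝ≥0∞).toReal - 1 / (2 : ℝ≥0∞).toReal)) := by
    intro k
    have h1 : eLpNorm ((fun s => NormedSpace.exp ((-s) • A) (B (f k s).fst)) -
        fun s => NormedSpace.exp ((-s) • A) (B (g s).fst)) 1 ν ≤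
        ENNReal.ofReal (K * ‖L‖) * eLpNorm (⇑(f k) - ⇑g) 1 ν := by
      refine eLpNorm_le_mul_eLpNorm_of_ae_le_mul ?_ 1
      filter_upwards [ae_restrict_mem measurableSet_Ioc] with s hs
      have e : NormedSpace.exp ((-s) • A) (B (f k s).fst) -
          NormedSpace.exp ((-s) • A) (B (g s).fst) =
          NormedSpace.exp ((-s) • A) (L (f k s - g s)) := by
        simp [L]
      simp only [Pi.sub_apply]
      rw [e]
      calc _ ≤ ‖NormedSpace.exp ((-s) • A)‖ * ‖L (f k s - g s)‖ :=
            ContinuousLinearMap.le_opNorm _ _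
        _ ≤ K * (‖L‖ * ‖f k s - g s‖) :=
            mul_le_mul (hK s (Ioc_subset_Icc_self hs)) (L.le_opNorm _) (norm_nonneg _) hK0
        _ = _ := by ring
    refine h1.trans (mul_le_mul_right ?_ _)
    have hm : AEStronglyMeasurable (⇑(f k) - ⇑g) (volume.restrict (Ici 0)) :=
      (Lp.aestronglyMeasurable _).sub (Lp.aestronglyMeasurable _)
    exact (eLpNorm_le_eLpNorm_mul_rpow_measure_univ (by norm_num) (hm.mono_measure hν)).trans
      (mul_le_mul_left (eLpNorm_mono_measure _ hν) _)
  have hlim := (Lp.tendsto_Lp_iff_tendsto_eLpNorm' _ _).mp hf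
  have hfin : ν univ ^ (1 / (1 : ℝ≥0∞).toReal - 1 / (2 : ℝ≥0∞).toReal) ≠ ∞ := by
    refine ENNReal.rpow_ne_top_of_nonneg (by norm_num) (measure_ne_top _ _)
  have hlim2 := ENNReal.Tendsto.const_mul (a := ENNReal.ofReal (K * ‖L‖))
    (ENNReal.Tendsto.mul_const hlim (Or.inr hfin)) (Or.inr ENNReal.ofReal_ne_top)
  rw [zero_mul, mul_zero] at hlim2
  exact tendsto_of_tendsto_of_tendsto_of_le_of_le tendsto_const_nhds hlim2
    (fun _ => zero_le) hbound

/-- Along an `L²` convergent sequence the states converge at every time, while the outputs converge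
almost everywhere after passing to a subsequence, so the constraint survives in the limit. -/
theorem isClosed_outputFibre (A : E →L[ℝ] E) (B : U →L[ℝ] E) (C : E →L[ℝ] Y) (I : Set ℝ) (ξ : E) :
    IsClosed {g | (ξ, g) ∈ outputFibre A B C I} := by
  refine IsSeqClosed.isClosed fun f g hf hfg => ?_
  obtain ⟨φ, hφ, hae⟩ := (tendstoInMeasure_of_tendsto_Lp hfg).exists_seq_tendsto_ae
  have hall := ae_all_iff.2 fun k => mem_outputFibre.1 (hf k)
  refine mem_outputFibre.2 ?_
  filter_upwards [hae, hall, ae_restrict_mem measurableSet_Ici] with s h1 h2 h3 h4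
  have h5 := ((C.continuous.tendsto _).comp (tendsto_traj A B ξ h3 hfg)).comp hφ.tendsto_atTop
  have h6 := ((WithLp.sndL 2 ℝ U Y).continuous.tendsto _).comp h1
  refine tendsto_nhds_unique h6 (h5.congr fun k => ?_)
  exact (h2 (φ k) h4).symm

theorem outputFibre_anti (A : E →L[ℝ] E) (B : U →L[ℝ] E) (C : E →L[ℝ] Y) {I J : Set ℝ}
    (h : I ⊆ J) : outputFibre A B C J ≤ outputFibre A B C I := by
  rintro ⟨ξ, g⟩ hg
  rw [mem_outputFibre] at hg ⊢
  filter_upwards [hg] with s hs h' using hs (h h')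

theorem mem_outputFibre_Ici {A : E →L[ℝ] E} {B : U →L[ℝ] E} {C : E →L[ℝ] Y}
    {z : E × Lp (WithLp 2 (U × Y)) 2 (volume.restrict (Ici (0 : ℝ)))}
    (h : ∀ T, z ∈ outputFibre A B C (Icc 0 T)) : z ∈ outputFibre A B C (Ici 0) := by
  have hall := ae_all_iff.2 fun k : ℕ => mem_outputFibre.1 (h k)
  refine mem_outputFibre.2 ?_
  filter_upwards [hall] with s hs h0
  obtain ⟨k, hk⟩ := exists_nat_ge s
  exact hs k ⟨h0, hk⟩

end Fibre

/-! ### Matrices acting on Euclidean spaces, and their quadratic forms. -/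

section Matrices

variable {k l : ℕ}

/-- `matAct` as a continuous linear map. -/
noncomputable def matCLM (M : Matrix (Fin k) (Fin l) ℝ) :
    EuclideanSpace ℝ (Fin l) →L[ℝ] EuclideanSpace ℝ (Fin k) :=
  LinearMap.toContinuousLinearMap (Matrix.toLpLin 2 2 M)

theorem inner_matAct_left (M : Matrix (Fin k) (Fin l) ℝ) (x : EuclideanSpace ℝ (Fin l))
    (y : EuclideanSpace ℝ (Fin k)) : inner ℝ (matAct M x) y = inner ℝ x (matAct Mᵀ y) := by
  simp only [matAct, PiLp.inner_apply, RCLike.inner_apply, conj_trivial]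
  have := Matrix.dotProduct_mulVec y.ofLp M x.ofLp
  rw [← Matrix.mulVec_transpose] at this
  simp only [dotProduct] at this
  rw [this]

theorem Matrix.IsSymm.eq_zero_of_inner_matAct_self {M : Matrix (Fin k) (Fin k) ℝ} (hM : M.IsSymm)
    (h : ∀ ξ, inner ℝ (matAct M ξ) ξ = (0 : ℝ)) : M = 0 := by
  have hs : (Matrix.toLpLin 2 2 M : EuclideanSpace ℝ (Fin k) →ₗ[ℝ] _).IsSymmetric := by
    intro x y
    have := inner_matAct_left M x y
    rwa [hM.eq] at this
  have := hs.inner_map_self_eq_zero.1 h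
  exact (Matrix.toLpLin 2 2).map_eq_zero_iff.1 this

theorem matAct_mul {j : ℕ} (M : Matrix (Fin k) (Fin l) ℝ) (N : Matrix (Fin l) (Fin j) ℝ)
    (x : EuclideanSpace ℝ (Fin j)) : matAct (M * N) x = matAct M (matAct N x) := by
  simp [matAct, Matrix.mulVec_mulVec]

theorem matAct_add (M N : Matrix (Fin k) (Fin l) ℝ)
    (x : EuclideanSpace ℝ (Fin l)) : matAct (M + N) x = matAct M x + matAct N x := by
  simp [matAct, Matrix.add_mulVec]

theorem matAct_sub (M N : Matrix (Fin k) (Fin l) ℝ)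
    (x : EuclideanSpace ℝ (Fin l)) : matAct (M - N) x = matAct M x - matAct N x := by
  simp [matAct, Matrix.sub_mulVec]

/-- Turns the squared norm of a least-norm section into a matrix; `P` and every `P_T` are obtained
this way. -/
theorem inner_matAct_gram {H : Type*} [NormedAddCommGroup H] [InnerProductSpace ℝ H]
    (F : EuclideanSpace ℝ (Fin k) →ₗ[ℝ] H) (ξ : EuclideanSpace ℝ (Fin k)) :
    inner ℝ (matAct (Matrix.gram ℝ fun i => F (EuclideanSpace.single i 1)) ξ) ξ = ‖F ξ‖ ^ 2 := by
  have hF : F ξ = ∑ i, ξ i • F (EuclideanSpace.single i 1) := by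
    conv_lhs => rw [← (EuclideanSpace.basisFun (Fin k) ℝ).sum_repr ξ]
    simp [map_sum]
  rw [← real_inner_self_eq_norm_sq, hF, sum_inner]
  simp only [matAct, PiLp.inner_apply, RCLike.inner_apply, conj_trivial, Matrix.mulVec, dotProduct,
    Matrix.gram_apply, inner_sum, inner_smul_left, inner_smul_right, Finset.mul_sum]
  refine Finset.sum_congr rfl fun i _ => Finset.sum_congr rfl fun j _ => by ring

end Matrices

/-! ### The control problem as a least-norm problem: value matrices, optimal solutions, limit of
horizons. -/

namespace LQ

variable {n p m : ℕ} {A : Matrix (Fin n) (Fin n) ℝ} {B : Matrix (Fin n) (Fin p) ℝ}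
  {C : Matrix (Fin m) (Fin n) ℝ} {I J : Set ℝ} {ξ : EuclideanSpace ℝ (Fin n)}
  {u : ℝ → EuclideanSpace ℝ (Fin p)} {x : ℝ → EuclideanSpace ℝ (Fin n)}

/-- The Hilbert space of square integrable pairs `(control, output)`. -/
noncomputable abbrev Signal (p m : ℕ) :=
  Lp (WithLp 2 (EuclideanSpace ℝ (Fin p) × EuclideanSpace ℝ (Fin m))) 2
    (volume.restrict (Ici (0 : ℝ)))

/-- The linear relation between initial states and signals on the interval `I`. -/
noncomputable abbrev fibre (A : Matrix (Fin n) (Fin n) ℝ) (B : Matrix (Fin n) (Fin p) ℝ)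
    (C : Matrix (Fin m) (Fin n) ℝ) (I : Set ℝ) :
    Submodule ℝ (EuclideanSpace ℝ (Fin n) × Signal p m) :=
  outputFibre (matCLM A) (matCLM B) (matCLM C) I

theorem IsSolution.mono (h : IsSolution A B I ξ u x) (hJ : J ⊆ I) : IsSolution A B J ξ u x :=
  ⟨h.memLp.mono_measure (Measure.restrict_mono hJ le_rfl), h.continuousOn.mono hJ,
    fun t ht => h.eq_integral t (hJ ht)⟩

theorem IsSolution.integrableOn (h : IsSolution A B I ξ u x) {t : ℝ} (ht : Icc 0 t ⊆ I) :
    IntegrableOn u (Ioc 0 t) :=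
  integrableOn_Ioc_of_memLp_two (Ioc_subset_Icc_self.trans ht) h.memLp

theorem IsSolution.eq_traj (h : IsSolution A B I ξ u x) {t : ℝ} (ht0 : 0 ≤ t) (ht : Icc 0 t ⊆ I) :
    x t = traj (matCLM A) ξ (fun s => matCLM B (u s)) t :=
  _root_.eq_traj (matCLM A) ht0 ((matCLM B).integrable_comp (h.integrableOn ht))
    (h.continuousOn.mono ht) fun s hs => h.eq_integral s (ht hs)

theorem isSolution_traj (hu : MemLp u 2 (volume.restrict (Ici 0))) :
    IsSolution A B (Ici 0) ξ u (traj (matCLM A) ξ fun s => matCLM B (u s)) := by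
  have hb : ∀ t, IntegrableOn (fun s => matCLM B (u s)) (Ioc 0 t) := fun t =>
    (matCLM B).integrable_comp (integrableOn_Ioc_of_memLp_two (fun _ hs => hs.1.le) hu)
  refine ⟨hu, fun t ht => ?_, fun t ht => traj_eq_integral _ ξ ht (hb t)⟩
  -- The horizon `t + 1` makes `[0, t + 1]` a neighbourhood of `t` within `[0,∞)`.
  have h1 := continuousOn_traj (matCLM A) ξ (hb (t + 1)) t ⟨ht, by linarith⟩
  refine h1.mono_of_mem_nhdsWithin ?_
  filter_upwards [self_mem_nhdsWithin, mem_nhdsWithin_of_mem_nhds (Iic_mem_nhds (lt_add_one t))]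
    with s h2 h3 using ⟨h2, h3⟩

theorem ofReal_norm_sq (g : Signal p m) : ENNReal.ofReal (‖g‖ ^ 2) =
    ∫⁻ s in Ici (0 : ℝ), ENNReal.ofReal (‖(g s).snd‖ ^ 2 + ‖(g s).fst‖ ^ 2) := by
  have h1 : ‖g‖ ^ 2 = ∫ s in Ici (0 : ℝ), (‖(g s).snd‖ ^ 2 + ‖(g s).fst‖ ^ 2) := by
    rw [← real_inner_self_eq_norm_sq, L2.inner_def]
    simp only [real_inner_self_eq_norm_sq, WithLp.prod_norm_sq_eq_of_L2, add_comm]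
  have h2 : Integrable (fun s => ‖(g s).snd‖ ^ 2 + ‖(g s).fst‖ ^ 2)
      (volume.restrict (Ici (0 : ℝ))) := by
    have := L2.integrable_inner (𝕜 := ℝ) g g
    simpa only [real_inner_self_eq_norm_sq, WithLp.prod_norm_sq_eq_of_L2, add_comm] using this
  rw [h1, ofReal_integral_eq_lintegral_ofReal h2 (Eventually.of_forall fun s => by positivity)]

theorem memLp_fst (g : Signal p m) : MemLp (fun s => (g s).fst) 2 (volume.restrict (Ici 0)) :=
  (WithLp.fstL 2 ℝ (EuclideanSpace ℝ (Fin p)) (EuclideanSpace ℝ (Fin m))).comp_memLp' (Lp.memLp g)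

/-- A finite cost solution on `I` is given by an element of the fibre with the same energy. -/
theorem IsSolution.exists_fibre (h : IsSolution A B I ξ u x) (hI : I.OrdConnected) (h0 : 0 ∈ I)
    (hI0 : I ⊆ Ici 0) (hc : cost C I u x ≠ ∞) :
    ∃ g : Signal p m, (ξ, g) ∈ fibre A B C I ∧ ENNReal.ofReal (‖g‖ ^ 2) = cost C I u x ∧
      (fun s => (g s).fst) =ᵐ[volume.restrict I] u := by
  have hIm : MeasurableSet I := hI.measurableSet
  let g₀ : ℝ → WithLp 2 (EuclideanSpace ℝ (Fin p) × EuclideanSpace ℝ (Fin m)) :=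
    fun s => WithLp.toLp 2 (u s, matCLM C (x s))
  have hm : AEStronglyMeasurable g₀ (volume.restrict I) :=
    (WithLp.prod_continuous_toLp 2 _ _).comp_aestronglyMeasurable
      (h.memLp.1.prodMk (((matCLM C).continuous.comp_continuousOn h.continuousOn).aestronglyMeasurable
        hIm))
  have hmem : MemLp g₀ 2 (volume.restrict I) := by
    rw [memLp_two_iff_integrable_sq_norm hm]
    refine ⟨(hm.norm.pow 2), ?_⟩
    rw [hasFiniteIntegral_iff_ofReal (Eventually.of_forall fun s => by positivity)]
    refine lt_of_le_of_lt (le_of_eq ?_) (lt_top_iff_ne_top.2 hc)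
    refine lintegral_congr fun s => ?_
    rw [WithLp.prod_norm_sq_eq_of_L2, add_comm]
    rfl
  -- Extension by zero outside `I` adds no energy and stays in the fibre, which constrains the
  -- signal only on `I`.
  have hmem' : MemLp (I.indicator g₀) 2 (volume.restrict (Ici 0)) := by
    rw [memLp_indicator_iff_restrict hIm, Measure.restrict_restrict hIm,
      inter_eq_left.2 hI0]
    exact hmem
  have hg : ⇑(hmem'.toLp _) =ᵐ[volume.restrict (Ici 0)] I.indicator g₀ := hmem'.coeFn_toLp
  have hgI : ∀ J : Set ℝ, MeasurableSet J → J ⊆ I →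
      ∀ᵐ s ∂(volume.restrict J), hmem'.toLp _ s = g₀ s := by
    intro J hJm hJ
    filter_upwards [ae_restrict_of_ae_restrict_of_subset (hJ.trans hI0) hg,
      ae_restrict_mem hJm] with s h1 h2
    rw [h1, indicator_of_mem (hJ h2)]
  refine ⟨hmem'.toLp _, ?_, ?_, ?_⟩
  · rw [mem_outputFibre]
    filter_upwards [hg, ae_restrict_mem measurableSet_Ici] with s h1 h2 h3
    have hsub : Icc 0 s ⊆ I := hI.out h0 h3
    rw [h1, indicator_of_mem h3]
    change matCLM C (x s) = _
    rw [h.eq_traj h2 hsub]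
    congr 1
    refine traj_congr _ _ h2 ?_
    filter_upwards [hgI _ measurableSet_Ioc (Ioc_subset_Icc_self.trans hsub)] with r hr
    rw [hr]; rfl
  · have hcost : cost C I u x = ∫⁻ s in Ici (0 : ℝ),
        I.indicator (fun s => ENNReal.ofReal (‖matAct C (x s)‖ ^ 2 + ‖u s‖ ^ 2)) s := by
      rw [setLIntegral_indicator hIm, inter_eq_left.2 hI0, cost]
    rw [ofReal_norm_sq, hcost]
    refine lintegral_congr_ae ?_
    filter_upwards [hg] with s hs
    rw [hs]
    by_cases h3 : s ∈ I
    · simp only [indicator_of_mem h3]; rfl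
    · simp [indicator_of_notMem h3]
  · filter_upwards [hgI I hIm le_rfl] with s hs
    rw [hs]; rfl

/-- Only an inequality, since `g` may carry energy outside `I`. -/
theorem cost_le_of_mem_fibre {g : Signal p m} (hg : (ξ, g) ∈ fibre A B C I) (hIm : MeasurableSet I)
    (hI0 : I ⊆ Ici 0) :
    cost C I (fun s => (g s).fst) (traj (matCLM A) ξ fun s => matCLM B (g s).fst) ≤
      ENNReal.ofReal (‖g‖ ^ 2) := by
  rw [ofReal_norm_sq]
  refine le_trans (le_of_eq ?_) (lintegral_mono_set hI0)
  refine lintegral_congr_ae ?_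
  filter_upwards [ae_restrict_of_ae_restrict_of_subset hI0 (mem_outputFibre.1 hg),
    ae_restrict_mem hIm] with s h1 h2
  rw [h1 h2]; rfl

theorem IsMinSection.value_eq {F : EuclideanSpace ℝ (Fin n) →ₗ[ℝ] Signal p m}
    (hF : IsMinSection (fibre A B C I) F) (hI : I.OrdConnected) (h0 : 0 ∈ I)
    (hI0 : I ⊆ Ici 0) (ξ : EuclideanSpace ℝ (Fin n)) :
    value A B C I ξ = ENNReal.ofReal (‖F ξ‖ ^ 2) := by
  refine le_antisymm ?_ ?_
  · refine le_trans ?_ (cost_le_of_mem_fibre (hF.mem ξ) hI.measurableSet hI0)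
    exact iInf_le_of_le _ (iInf_le_of_le _ (iInf_le _ ((isSolution_traj (memLp_fst _)).mono hI0)))
  · refine le_iInf fun u => le_iInf fun x => le_iInf fun h => ?_
    by_cases hc : cost C I u x = ∞
    · rw [hc]; exact le_top
    obtain ⟨g, hg, hgc, -⟩ := h.exists_fibre hI h0 hI0 hc
    rw [← hgc]
    exact ENNReal.ofReal_le_ofReal (hF.norm_le hg)

theorem IsMinSection.isValueMatrix {F : EuclideanSpace ℝ (Fin n) →ₗ[ℝ] Signal p m}
    (hF : IsMinSection (fibre A B C I) F) (hI : I.OrdConnected) (h0 : 0 ∈ I)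
    (hI0 : I ⊆ Ici 0) :
    IsValueMatrix A B C I (Matrix.gram ℝ fun i => F (EuclideanSpace.single i 1)) where
  isSymm := by ext i j; simp [Matrix.gram_apply, real_inner_comm]
  value_ne_top ξ := by rw [IsMinSection.value_eq hF hI h0 hI0]; exact ENNReal.ofReal_ne_top
  inner_eq ξ := by
    rw [IsMinSection.value_eq hF hI h0 hI0, ENNReal.toReal_ofReal (sq_nonneg _), inner_matAct_gram]

theorem IsValueMatrix.unique {P Q : Matrix (Fin n) (Fin n) ℝ} (hP : IsValueMatrix A B C I P)
    (hQ : IsValueMatrix A B C I Q) : Q = P := by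
  refine sub_eq_zero.1 ((hQ.isSymm.sub hP.isSymm).eq_zero_of_inner_matAct_self fun ξ => ?_)
  rw [matAct_sub, inner_sub_left, hP.inner_eq, hQ.inner_eq, sub_self]

/-- The finite cost condition serves to make the fibres nonempty: a finite cost solution on `[0,∞)`
restricts to one on `I`. -/
theorem exists_isMinSection_fibre (hfin : FiniteCost A B C) (hI : I.OrdConnected) (h0 : 0 ∈ I)
    (hI0 : I ⊆ Ici 0) : ∃ F, IsMinSection (fibre A B C I) F := by
  refine exists_isMinSection _ (isClosed_outputFibre _ _ _ _ _) fun ξ => ?_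
  obtain ⟨u, x, hs, hc⟩ := hfin ξ
  have hc' : cost C I u x ≠ ∞ := ((lintegral_mono_set hI0).trans_lt hc).ne
  obtain ⟨g, hg, -⟩ := (hs.mono hI0).exists_fibre hI h0 hI0 hc'
  exact ⟨g, hg⟩

theorem IsMinSection.isOptimal {F : EuclideanSpace ℝ (Fin n) →ₗ[ℝ] Signal p m}
    (hF : IsMinSection (fibre A B C (Ici 0)) F) (ξ : EuclideanSpace ℝ (Fin n)) :
    IsOptimal A B C (Ici 0) ξ (fun s => (F ξ s).fst)
      (traj (matCLM A) ξ fun s => matCLM B (F ξ s).fst) where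
  isSolution := isSolution_traj (memLp_fst _)
  cost_eq := by
    refine le_antisymm ?_ ?_
    · rw [IsMinSection.value_eq hF ordConnected_Ici self_mem_Ici le_rfl]
      exact cost_le_of_mem_fibre (hF.mem ξ) measurableSet_Ici le_rfl
    · exact iInf_le_of_le _ (iInf_le_of_le _ (iInf_le _ (isSolution_traj (memLp_fst _))))

/-- The signal of an optimal pair has least norm in its fibre, hence is `F ξ`. This fixes the
control almost everywhere, and variation of constants then fixes the state at every time. -/
theorem IsMinSection.isOptimal_unique {F : EuclideanSpace ℝ (Fin n) →ₗ[ℝ] Signal p m}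
    (hF : IsMinSection (fibre A B C (Ici 0)) F) (h : IsOptimal A B C (Ici 0) ξ u x) :
    u =ᵐ[volume.restrict (Ici 0)] (fun s => (F ξ s).fst) ∧
      EqOn x (traj (matCLM A) ξ fun s => matCLM B (F ξ s).fst) (Ici 0) := by
  have hv := IsMinSection.value_eq hF ordConnected_Ici self_mem_Ici le_rfl ξ
  obtain ⟨g, hg, hgc, hgu⟩ := h.isSolution.exists_fibre (C := C) ordConnected_Ici self_mem_Ici
    le_rfl (by rw [h.cost_eq, hv]; exact ENNReal.ofReal_ne_top)
  have hgF : g = F ξ := by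
    refine hF.eq_of_norm_le hg (le_of_eq ?_)
    rw [h.cost_eq, hv] at hgc
    exact (ENNReal.ofReal_eq_ofReal_iff (sq_nonneg _) (sq_nonneg _)).1 hgc
  subst hgF
  refine ⟨hgu.symm, fun t ht => ?_⟩
  rw [h.isSolution.eq_traj ht (fun s hs => hs.1)]
  refine traj_congr _ _ ht ?_
  filter_upwards [ae_restrict_of_ae_restrict_of_subset
    (show Ioc 0 t ⊆ Ici 0 from fun _ hs => hs.1.le) hgu] with s hs
  rw [hs]

theorem exists_tendsto_valueMatrix (hfin : FiniteCost A B C)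
    {F : EuclideanSpace ℝ (Fin n) →ₗ[ℝ] Signal p m}
    (hF : IsMinSection (fibre A B C (Ici 0)) F) :
    ∃ PT : ℝ → Matrix (Fin n) (Fin n) ℝ,
      (∀ T : ℝ, 0 < T → IsValueMatrix A B C (Icc 0 T) (PT T)) ∧
      Tendsto PT atTop (𝓝 (Matrix.gram ℝ fun i => F (EuclideanSpace.single i 1))) := by
  have hex : ∀ T : ℝ, ∃ G, IsMinSection (fibre A B C (Icc 0 T)) G := by
    intro T
    rcases le_or_gt 0 T with hT | hT
    · exact exists_isMinSection_fibre hfin ordConnected_Icc ⟨le_rfl, hT⟩ fun s hs => hs.1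
    -- For `T < 0` the interval is empty and the fibre is the whole space; this case only completes
    -- the family indexed by all reals.
    · refine exists_isMinSection _ (isClosed_outputFibre _ _ _ _ _) fun ξ => ⟨0, ?_⟩
      simp [mem_outputFibre, Icc_eq_empty_of_lt hT]
  choose G hG using hex
  have hanti : Antitone fun T : ℝ => fibre A B C (Icc 0 T) := fun S T hST =>
    outputFibre_anti _ _ _ (Icc_subset_Icc_right hST)
  have hle : ∀ T, fibre A B C (Ici 0) ≤ fibre A B C (Icc 0 T) := fun T =>
    outputFibre_anti _ _ _ fun s hs => hs.1
  have hlim : ∀ ξ, Tendsto (fun T => G T ξ) atTop (𝓝 (F ξ)) :=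
    _root_.IsMinSection.tendsto hanti hG hF hle (fun z hz => mem_outputFibre_Ici hz)
      (fun T ξ => isClosed_outputFibre _ _ _ _ ξ)
  refine ⟨fun T => Matrix.gram ℝ fun i => G T (EuclideanSpace.single i 1), fun T hT =>
    IsMinSection.isValueMatrix (hG T) ordConnected_Icc ⟨le_rfl, hT.le⟩ fun s hs => hs.1, ?_⟩
  refine tendsto_pi_nhds.2 fun i => tendsto_pi_nhds.2 fun j => ?_
  exact (hlim _).inner (hlim _)

end LQ

/-- Passes from integral inequalities on short intervals to a pointwise one at time `0`, without
differentiating: if `φ 0 < 0`, then `φ < φ 0 / 2` near `0` and a short integral is negative. -/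
theorem nonneg_of_integral_nonneg {φ : ℝ → ℝ} (hφ : ContinuousOn φ (Icc 0 1))
    (h : ∀ t ∈ Ioc (0 : ℝ) 1, 0 ≤ ∫ s in (0 : ℝ)..t, φ s) : 0 ≤ φ 0 := by
  by_contra! hneg
  have h1 : ∀ᶠ s in 𝓝[Icc 0 1] (0 : ℝ), φ s < φ 0 / 2 :=
    (hφ 0 ⟨le_rfl, zero_le_one⟩).eventually_lt_const (by linarith)
  obtain ⟨δ, hδ, hsub⟩ := Metric.mem_nhdsWithin_iff.1 h1
  set t := min 1 (δ / 2)
  have ht0 : 0 < t := lt_min one_pos (by linarith)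
  have ht1 : t ≤ 1 := min_le_left _ _
  have htδ : t < δ := (min_le_right _ _).trans_lt (by linarith)
  have h2 : ∫ s in (0 : ℝ)..t, φ s ≤ ∫ _ in (0 : ℝ)..t, φ 0 / 2 := by
    refine intervalIntegral.integral_mono_on ht0.le ?_ (by simp) fun s hs => ?_
    · exact (hφ.mono (Icc_subset_Icc_right ht1)).intervalIntegrable_of_Icc ht0.le
    · refine le_of_lt (hsub ⟨?_, hs.1, hs.2.trans ht1⟩)
      rw [Metric.mem_ball, Real.dist_eq, sub_zero, abs_of_nonneg hs.1]
      exact hs.2.trans_lt htδ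
  have h3 := h t ⟨ht0, ht1⟩
  rw [intervalIntegral.integral_const, smul_eq_mul, sub_zero] at h2
  nlinarith

/-! ### Dynamic programming: shifting and concatenating solutions. -/

namespace LQ

variable {n p m : ℕ} {A : Matrix (Fin n) (Fin n) ℝ} {B : Matrix (Fin n) (Fin p) ℝ}
  {C : Matrix (Fin m) (Fin n) ℝ} {P : Matrix (Fin n) (Fin n) ℝ} {ξ : EuclideanSpace ℝ (Fin n)}
  {u u' : ℝ → EuclideanSpace ℝ (Fin p)} {x x' : ℝ → EuclideanSpace ℝ (Fin n)} {h : ℝ}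

theorem IsSolution.integrableOn_rhs (hs : IsSolution A B (Ici 0) ξ u x) (t : ℝ) :
    IntegrableOn (fun s => matAct A (x s) + matAct B (u s)) (Ioc 0 t) :=
  ((((matCLM A).continuous.comp_continuousOn
    (hs.continuousOn.mono (fun _ h => h.1 : Icc 0 t ⊆ Ici 0))).integrableOn_Icc).mono_set
      Ioc_subset_Icc_self).add ((matCLM B).integrable_comp (hs.integrableOn fun _ h => h.1))

theorem IsSolution.apply_zero (hs : IsSolution A B (Ici 0) ξ u x) : x 0 = ξ := by
  simpa using hs.eq_integral 0 self_mem_Ici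

theorem IsSolution.shift (hs : IsSolution A B (Ici 0) ξ u x) (hh : 0 ≤ h) :
    IsSolution A B (Ici 0) (x h) (fun s => u (s + h)) (fun s => x (s + h)) where
  memLp := by
    have h1 : MemLp u 2 (volume.restrict (Ici h)) :=
      hs.memLp.mono_measure (Measure.restrict_mono (Ici_subset_Ici.2 hh) le_rfl)
    have h2 := (measurePreserving_add_right volume h).restrict_preimage
      (measurableSet_Ici (a := h))
    have h3 : (fun s => s + h) ⁻¹' Ici h = Ici 0 := by ext; simp
    rw [h3] at h2
    exact h1.comp_measurePreserving h2
  continuousOn := hs.continuousOn.comp (by fun_prop) fun s (hs : 0 ≤ s) => by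
    simpa using add_nonneg hs hh
  eq_integral t ht := by
    have ht' : 0 ≤ t := ht
    have hth : h ≤ t + h := by linarith
    rw [hs.eq_integral (t + h) (hh.trans hth), hs.eq_integral h hh, add_assoc,
      intervalIntegral.integral_comp_add_right fun s => matAct A (x s) + matAct B (u s), zero_add,
      intervalIntegral.integral_add_adjacent_intervals]
    · exact (intervalIntegrable_iff_integrableOn_Ioc_of_le hh).2 (hs.integrableOn_rhs h)
    · exact (intervalIntegrable_iff_integrableOn_Ioc_of_le hth).2
        ((hs.integrableOn_rhs (t + h)).mono_set (Ioc_subset_Ioc_left hh))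

theorem cost_Ici_eq_add (C : Matrix (Fin m) (Fin n) ℝ) (u : ℝ → EuclideanSpace ℝ (Fin p))
    (x : ℝ → EuclideanSpace ℝ (Fin n)) (hh : 0 ≤ h) : cost C (Ici 0) u x =
    cost C (Ico 0 h) u x + cost C (Ici 0) (fun s => u (s + h)) (fun s => x (s + h)) := by
  have h1 : cost C (Ici 0) (fun s => u (s + h)) (fun s => x (s + h)) = cost C (Ici h) u x := by
    simp only [cost]
    rw [← lintegral_indicator measurableSet_Ici, ← lintegral_indicator measurableSet_Ici,
      ← lintegral_add_right_eq_self
        ((Ici h).indicator fun s => ENNReal.ofReal (‖matAct C (x s)‖ ^ 2 + ‖u s‖ ^ 2)) h]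
    refine lintegral_congr fun s => ?_
    simp [indicator]
  rw [h1]
  simp only [cost]
  rw [← lintegral_union measurableSet_Ici, Ico_union_Ici_eq_Ici hh]
  exact Set.disjoint_left.2 fun s h1 h2 => absurd h1.2 (not_lt.2 h2)

theorem value_le_cost {I : Set ℝ} (hs : IsSolution A B I ξ u x) :
    value A B C I ξ ≤ cost C I u x :=
  iInf_le_of_le _ (iInf_le_of_le _ (iInf_le _ hs))

/-- The tail of an optimal solution is a competitor for the problem started at `x h`. -/
theorem IsOptimal.cost_add_value_le (ho : IsOptimal A B C (Ici 0) ξ u x) (hh : 0 ≤ h) :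
    cost C (Ico 0 h) u x + value A B C (Ici 0) (x h) ≤ value A B C (Ici 0) ξ := by
  rw [← ho.cost_eq, cost_Ici_eq_add C u x hh]
  gcongr
  exact value_le_cost (ho.isSolution.shift hh)

/-- The competitor follows `u` up to time `h` and then the optimal control for `x h`. -/
theorem IsSolution.value_le (hs : IsSolution A B (Ici 0) ξ u x) (hh : 0 ≤ h)
    (ho : IsOptimal A B C (Ici 0) (x h) u' x') :
    value A B C (Ici 0) ξ ≤ cost C (Ico 0 h) u x + value A B C (Ici 0) (x h) := by
  set v : ℝ → EuclideanSpace ℝ (Fin p) := (Iio h).piecewise u fun s => u' (s - h) with hv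
  have hvl : ∀ s, s < h → v s = u s := fun s hs => piecewise_eq_of_mem _ _ _ hs
  have hvr : ∀ s, 0 ≤ s → v (s + h) = u' s := fun s hs => by
    rw [hv, piecewise_eq_of_notMem _ _ _ (by simpa using hs), add_sub_cancel_right]
  have hvm : MemLp v 2 (volume.restrict (Ici 0)) := by
    refine MemLp.piecewise measurableSet_Iio
      (hs.memLp.mono_measure Measure.restrict_le_self) ?_
    have h2 := (measurePreserving_sub_right volume h).restrict_preimage
      (measurableSet_Ici (a := (0 : ℝ)))
    have h3 := ho.isSolution.memLp.comp_measurePreserving h2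
    refine h3.mono_measure ?_
    rw [Measure.restrict_restrict measurableSet_Iio.compl]
    refine Measure.restrict_mono (fun s hs => ?_) le_rfl
    simpa using hs.1
  have hy := isSolution_traj (A := A) (B := B) (ξ := ξ) hvm
  -- The state is not glued by hand: `y` is generated by `v`, then identified with `x` and with the
  -- shifted `x'` by variation of constants.
  set y := traj (matCLM A) ξ fun s => matCLM B (v s)
  have hyl : ∀ t ∈ Icc 0 h, y t = x t := fun t ht => by
    rw [hs.eq_traj ht.1 fun _ h => h.1]
    refine traj_congr _ _ ht.1 ?_
    have hne : ∀ᵐ s ∂(volume.restrict (Ioc 0 t)), s ≠ h :=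
      ae_restrict_of_ae (Measure.ae_ne volume h)
    filter_upwards [hne, ae_restrict_mem measurableSet_Ioc] with s h1 h2
    rw [hvl s (lt_of_le_of_ne (h2.2.trans ht.2) h1)]
  have hyr : ∀ t, 0 ≤ t → y (t + h) = x' t := fun t ht => by
    rw [(hy.shift hh).eq_traj (x := fun s => y (s + h)) ht fun _ h => h.1,
      ho.isSolution.eq_traj ht fun _ h => h.1, hyl h ⟨hh, le_rfl⟩]
    refine traj_congr _ _ ht ?_
    filter_upwards [ae_restrict_mem measurableSet_Ioc] with s hs
    rw [hvr s hs.1.le]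
  refine (value_le_cost hy).trans ?_
  rw [cost_Ici_eq_add C v y hh, ← ho.cost_eq]
  refine add_le_add (le_of_eq ?_) (le_of_eq ?_)
  · refine setLIntegral_congr_fun measurableSet_Ico fun s hs => ?_
    rw [hvl s hs.2, hyl s ⟨hs.1, hs.2.le⟩]
  · refine setLIntegral_congr_fun measurableSet_Ici fun s hs => ?_
    beta_reduce
    rw [hvr s hs, hyr s hs]

/-! ### Completion of the square, feedback law and Riccati equation. -/

/-- The left-hand side of the algebraic Riccati equation. -/
def riccati (A : Matrix (Fin n) (Fin n) ℝ) (B : Matrix (Fin n) (Fin p) ℝ)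
    (C : Matrix (Fin m) (Fin n) ℝ) (P : Matrix (Fin n) (Fin n) ℝ) : Matrix (Fin n) (Fin n) ℝ :=
  Aᵀ * P + P * A - P * B * Bᵀ * P + Cᵀ * C

theorem riccati_isSymm (hP : P.IsSymm) : (riccati A B C P).IsSymm := by
  unfold riccati Matrix.IsSymm
  simp only [Matrix.transpose_add, Matrix.transpose_sub, Matrix.transpose_mul,
    Matrix.transpose_transpose, hP.eq, Matrix.mul_assoc]
  rw [add_comm (P * A)]

/-- Completion of the square. -/
theorem running_cost_add_eq (hP : P.IsSymm) (a : EuclideanSpace ℝ (Fin n))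
    (b : EuclideanSpace ℝ (Fin p)) :
    (‖matAct C a‖ ^ 2 + ‖b‖ ^ 2) + (inner ℝ (matAct P (matAct A a + matAct B b)) a +
      inner ℝ (matAct P a) (matAct A a + matAct B b)) =
    inner ℝ (matAct (riccati A B C P) a) a + ‖b + matAct Bᵀ (matAct P a)‖ ^ 2 := by
  have hPs : ∀ y z, inner ℝ (matAct P y) z = inner ℝ y (matAct P z) := fun y z => by
    rw [inner_matAct_left, hP.eq]
  have h1 : inner ℝ (matAct (riccati A B C P) a) a = 2 * inner ℝ (matAct P a) (matAct A a) -
      ‖matAct Bᵀ (matAct P a)‖ ^ 2 + ‖matAct C a‖ ^ 2 := by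
    unfold riccati
    simp only [matAct_add, matAct_sub, matAct_mul, inner_add_left, inner_sub_left]
    rw [inner_matAct_left Aᵀ, Matrix.transpose_transpose, hPs (matAct A a), hPs (matAct B _),
      inner_matAct_left B, inner_matAct_left Cᵀ, Matrix.transpose_transpose,
      real_inner_self_eq_norm_sq, real_inner_self_eq_norm_sq,
      real_inner_comm (matAct A a)]
    ring
  have h2 : inner ℝ b (matAct Bᵀ (matAct P a)) = inner ℝ (matAct P a) (matAct B b) := by
    rw [← inner_matAct_left, real_inner_comm]
  rw [h1, norm_add_sq_real, h2, hPs (matAct A a + matAct B b), inner_add_left, inner_add_right,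
    real_inner_comm (matAct P a) (matAct A a), real_inner_comm (matAct P a) (matAct B b)]
  ring

theorem IsSolution.integrableOn_cost (hs : IsSolution A B (Ici 0) ξ u x) (t : ℝ) :
    IntegrableOn (fun s => ‖matAct C (x s)‖ ^ 2 + ‖u s‖ ^ 2) (Ioc 0 t) := by
  refine Integrable.add ?_ ?_
  · have : ContinuousOn (fun s => ‖matCLM C (x s)‖ ^ 2) (Icc 0 t) :=
      (((matCLM C).continuous.comp_continuousOn
        (hs.continuousOn.mono (fun _ h => h.1))).norm).pow 2
    exact this.integrableOn_Icc.mono_set Ioc_subset_Icc_self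
  · have := hs.memLp.mono_measure (Measure.restrict_mono
      (fun _ hs => hs.1.le : Ioc 0 t ⊆ Ici 0) le_rfl)
    exact (memLp_two_iff_integrable_sq_norm this.1).1 this

theorem IsSolution.cost_Ico (hs : IsSolution A B (Ici 0) ξ u x) (hh : 0 ≤ h) :
    cost C (Ico 0 h) u x =
      ENNReal.ofReal (∫ s in (0 : ℝ)..h, (‖matAct C (x s)‖ ^ 2 + ‖u s‖ ^ 2)) := by
  rw [intervalIntegral.integral_of_le hh, cost, ofReal_integral_eq_lintegral_ofReal
    (hs.integrableOn_cost h) (Eventually.of_forall fun s => by positivity)]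
  exact setLIntegral_congr Ico_ae_eq_Ioc

/-- The excess of the cost of a control over the value function. -/
noncomputable def excess (A : Matrix (Fin n) (Fin n) ℝ) (B : Matrix (Fin n) (Fin p) ℝ)
    (C : Matrix (Fin m) (Fin n) ℝ) (P : Matrix (Fin n) (Fin n) ℝ)
    (u : ℝ → EuclideanSpace ℝ (Fin p)) (x : ℝ → EuclideanSpace ℝ (Fin n)) (s : ℝ) : ℝ :=
  inner ℝ (matAct (riccati A B C P) (x s)) (x s) + ‖u s + matAct Bᵀ (matAct P (x s))‖ ^ 2

/-- The product rule for `⟨Px,x⟩` along the solution, followed by the pointwise identity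
`running_cost_add_eq`. -/
theorem IsSolution.integral_excess (hs : IsSolution A B (Ici 0) ξ u x) (hP : P.IsSymm)
    (hh : 0 ≤ h) : IntervalIntegrable (excess A B C P u x) volume 0 h ∧
    ∫ s in (0 : ℝ)..h, excess A B C P u x s =
      (∫ s in (0 : ℝ)..h, (‖matAct C (x s)‖ ^ 2 + ‖u s‖ ^ 2)) +
        (inner ℝ (matAct P (x h)) (x h) - inner ℝ (matAct P ξ) ξ) := by
  let L := (innerSL ℝ (E := EuclideanSpace ℝ (Fin n))).comp (matCLM P)
  have hx : ∀ s ∈ Icc 0 h, x s = ξ + ∫ r in (0 : ℝ)..s, (matAct A (x r) + matAct B (u r)) :=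
    fun s hs' => hs.eq_integral s hs'.1
  obtain ⟨hi, he⟩ := bilin_primitive L hh (hs.integrableOn_rhs h) (hs.integrableOn_rhs h) hx hx
  have hc := (intervalIntegrable_iff_integrableOn_Ioc_of_le hh).2 (hs.integrableOn_cost (C := C) h)
  have e : excess A B C P u x = fun s => (‖matAct C (x s)‖ ^ 2 + ‖u s‖ ^ 2) +
      (L (matAct A (x s) + matAct B (u s)) (x s) + L (x s) (matAct A (x s) + matAct B (u s))) :=
    funext fun s => (running_cost_add_eq hP (x s) (u s)).symm
  have he' : inner ℝ (matAct P (x h)) (x h) = inner ℝ (matAct P ξ) ξ + _ := he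
  rw [e]
  refine ⟨hc.add hi, ?_⟩
  rw [intervalIntegral.integral_add hc hi, he']
  ring

theorem IsValueMatrix.value_eq {I : Set ℝ} (hP : IsValueMatrix A B C I P)
    (ξ : EuclideanSpace ℝ (Fin n)) :
    value A B C I ξ = ENNReal.ofReal (inner ℝ (matAct P ξ) ξ) := by
  rw [hP.inner_eq, ENNReal.ofReal_toReal (hP.value_ne_top ξ)]

theorem IsValueMatrix.inner_nonneg {I : Set ℝ} (hP : IsValueMatrix A B C I P)
    (ξ : EuclideanSpace ℝ (Fin n)) : 0 ≤ inner ℝ (matAct P ξ) ξ := by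
  rw [hP.inner_eq]; exact ENNReal.toReal_nonneg

theorem integral_running_cost_nonneg (C : Matrix (Fin m) (Fin n) ℝ)
    (u : ℝ → EuclideanSpace ℝ (Fin p)) (x : ℝ → EuclideanSpace ℝ (Fin n)) (hh : 0 ≤ h) :
    0 ≤ ∫ s in (0 : ℝ)..h, (‖matAct C (x s)‖ ^ 2 + ‖u s‖ ^ 2) :=
  intervalIntegral.integral_nonneg hh fun s _ => by positivity

theorem IsValueMatrix.integral_excess_nonneg (hP : IsValueMatrix A B C (Ici 0) P)
    (hex : ∀ ξ, ∃ u x, IsOptimal A B C (Ici 0) ξ u x) (hs : IsSolution A B (Ici 0) ξ u x)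
    (hh : 0 ≤ h) : 0 ≤ ∫ s in (0 : ℝ)..h, excess A B C P u x s := by
  obtain ⟨u', x', ho⟩ := hex (x h)
  have h1 := hs.value_le hh ho
  have h2 := integral_running_cost_nonneg C u x hh
  have h3 := hP.inner_nonneg (x h)
  rw [hs.cost_Ico hh, hP.value_eq, hP.value_eq, ← ENNReal.ofReal_add h2 h3,
    ENNReal.ofReal_le_ofReal_iff (add_nonneg h2 h3)] at h1
  rw [(hs.integral_excess hP.isSymm hh).2]
  linarith

theorem IsValueMatrix.integral_excess_nonpos (hP : IsValueMatrix A B C (Ici 0) P)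
    (ho : IsOptimal A B C (Ici 0) ξ u x) (hh : 0 ≤ h) :
    ∫ s in (0 : ℝ)..h, excess A B C P u x s ≤ 0 := by
  have h1 := ho.cost_add_value_le hh
  have h2 := integral_running_cost_nonneg C u x hh
  have h3 := hP.inner_nonneg (x h)
  rw [ho.isSolution.cost_Ico hh, hP.value_eq, hP.value_eq, ← ENNReal.ofReal_add h2 h3,
    ENNReal.ofReal_le_ofReal_iff (hP.inner_nonneg ξ)] at h1
  rw [(ho.isSolution.integral_excess hP.isSymm hh).2]
  linarith

theorem continuousOn_inner_matAct {s : Set ℝ} (M : Matrix (Fin n) (Fin n) ℝ)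
    (hx : ContinuousOn x s) : ContinuousOn (fun t => inner ℝ (matAct M (x t)) (x t)) s :=
  ((matCLM M).continuous.comp_continuousOn hx).inner hx

/-- The Hamilton-Jacobi inequality. -/
theorem IsValueMatrix.inner_riccati_nonneg (hP : IsValueMatrix A B C (Ici 0) P)
    (hex : ∀ ξ, ∃ u x, IsOptimal A B C (Ici 0) ξ u x) (ξ : EuclideanSpace ℝ (Fin n)) :
    0 ≤ inner ℝ (matAct (riccati A B C P) ξ) ξ := by
  -- The constant control that makes the square in the excess vanish at time `0`, cut off to `[0,1]`
  -- so that it lies in `L²`.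
  set v := -matAct Bᵀ (matAct P ξ) with hv
  have hu : MemLp ((Icc (0 : ℝ) 1).indicator fun _ => v) 2 (volume.restrict (Ici 0)) :=
    memLp_indicator_const 2 measurableSet_Icc v (Or.inr (measure_ne_top_of_subset
      (subset_refl _) (by rw [Measure.restrict_apply measurableSet_Icc]
                          exact ((measure_mono inter_subset_left).trans_lt (by simp)).ne)))
  have hs := isSolution_traj (A := A) (B := B) (ξ := ξ) hu
  set x := traj (matCLM A) ξ fun s => matCLM B ((Icc (0 : ℝ) 1).indicator (fun _ => v) s)
  have hx0 : x 0 = ξ := hs.apply_zero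
  have hxc : ContinuousOn x (Icc 0 1) := hs.continuousOn.mono fun _ h => h.1
  -- The uncut constant control makes the excess continuous, and agrees with the cut one on `[0,1]`.
  have key := nonneg_of_integral_nonneg (φ := excess A B C P (fun _ => v) x) ?_ ?_
  · rw [excess, hx0, hv, neg_add_cancel, norm_zero] at key
    simpa using key
  · exact (continuousOn_inner_matAct _ hxc).add (((continuousOn_const.add
      ((matCLM Bᵀ).continuous.comp_continuousOn
        ((matCLM P).continuous.comp_continuousOn hxc))).norm).pow 2)
  · intro t ht
    refine (hP.integral_excess_nonneg hex hs ht.1.le).trans (le_of_eq ?_)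
    refine intervalIntegral.integral_congr fun s hs' => ?_
    rw [uIcc_of_le ht.1.le] at hs'
    simp only [excess]
    rw [indicator_of_mem (show s ∈ Icc 0 1 from ⟨hs'.1, hs'.2.trans ht.2⟩)]

/-- Under optimality the excess has nonpositive integral, yet it is a sum of two nonnegative terms;
both must vanish almost everywhere. -/
theorem IsValueMatrix.excess_ae_eq_zero (hP : IsValueMatrix A B C (Ici 0) P)
    (hR : ∀ ξ, 0 ≤ inner ℝ (matAct (riccati A B C P) ξ) ξ)
    (ho : IsOptimal A B C (Ici 0) ξ u x) (hh : 0 ≤ h) :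
    ∀ᵐ s ∂(volume.restrict (Ioc 0 h)), inner ℝ (matAct (riccati A B C P) (x s)) (x s) = (0 : ℝ) ∧
      u s = -matAct Bᵀ (matAct P (x s)) := by
  have hnn : ∀ s, 0 ≤ excess A B C P u x s := fun s => add_nonneg (hR _) (sq_nonneg _)
  obtain ⟨hi, -⟩ := ho.isSolution.integral_excess (C := C) hP.isSymm hh
  have h0 := le_antisymm (hP.integral_excess_nonpos ho hh)
    (intervalIntegral.integral_nonneg hh fun s _ => hnn s)
  rw [intervalIntegral.integral_of_le hh, integral_eq_zero_iff_of_nonneg hnn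
    ((intervalIntegrable_iff_integrableOn_Ioc_of_le hh).1 hi)] at h0
  filter_upwards [h0] with s hs
  have hs' := (add_eq_zero_iff_of_nonneg (hR (x s)) (sq_nonneg _)).1 hs
  exact ⟨hs'.1, eq_neg_of_add_eq_zero_left (norm_eq_zero.1 (pow_eq_zero_iff two_ne_zero |>.1 hs'.2))⟩

theorem IsValueMatrix.riccati_eq_zero (hP : IsValueMatrix A B C (Ici 0) P)
    (hex : ∀ ξ, ∃ u x, IsOptimal A B C (Ici 0) ξ u x) : riccati A B C P = 0 := by
  have hR := hP.inner_riccati_nonneg hex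
  refine (riccati_isSymm hP.isSymm).eq_zero_of_inner_matAct_self fun ξ => ?_
  refine le_antisymm ?_ (hR ξ)
  obtain ⟨u, x, ho⟩ := hex ξ
  -- The form vanishes almost everywhere along the optimal trajectory from `ξ`, and the trajectory
  -- is continuous, so the value at time `0`, where the state is `ξ`, is controlled too.
  have key := nonneg_of_integral_nonneg
    (φ := fun s => -inner ℝ (matAct (riccati A B C P) (x s)) (x s))
    (continuousOn_inner_matAct _ (ho.isSolution.continuousOn.mono fun _ h => h.1)).neg
    fun t ht => by
      rw [intervalIntegral.integral_of_le ht.1.le, integral_eq_zero_of_ae]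
      filter_upwards [hP.excess_ae_eq_zero hR ho ht.1.le] with s hs
      simp [hs.1]
  rw [ho.isSolution.apply_zero] at key
  linarith

theorem IsValueMatrix.feedback (hP : IsValueMatrix A B C (Ici 0) P)
    (hex : ∀ ξ, ∃ u x, IsOptimal A B C (Ici 0) ξ u x) (ho : IsOptimal A B C (Ici 0) ξ u x) :
    ∀ᵐ t ∂(volume.restrict (Ici (0 : ℝ))), u t = -matAct Bᵀ (matAct P (x t)) := by
  have hall := ae_all_iff.2 fun k : ℕ => (ae_restrict_iff' measurableSet_Ioc).1
    (hP.excess_ae_eq_zero (hP.inner_riccati_nonneg hex) ho k.cast_nonneg)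
  rw [ae_restrict_iff' measurableSet_Ici]
  filter_upwards [hall, Measure.ae_ne volume (0 : ℝ)] with s h1 h2 h3
  obtain ⟨k, hk⟩ := exists_nat_ge s
  exact (h1 k ⟨lt_of_le_of_ne h3 h2.symm, hk⟩).2

end LQ

theorem theorem9p2 {n p m : ℕ} (A : Matrix (Fin n) (Fin n) ℝ) (B : Matrix (Fin n) (Fin p) ℝ)
    (C : Matrix (Fin m) (Fin n) ℝ) (hfin : LQ.FiniteCost A B C) :
    ∃ P : Matrix (Fin n) (Fin n) ℝ,
      -- `P` is the unique symmetric matrix with `⟨P ξ, ξ⟩` equal to the infinite-horizon value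
      LQ.IsValueMatrix A B C (Ici 0) P ∧
      (∀ Q : Matrix (Fin n) (Fin n) ℝ, LQ.IsValueMatrix A B C (Ici 0) Q → Q = P) ∧
      -- `P` is the limit of the finite-horizon value matrices (without final cost)
      (∃ PT : ℝ → Matrix (Fin n) (Fin n) ℝ,
        (∀ T : ℝ, 0 < T → LQ.IsValueMatrix A B C (Icc 0 T) (PT T)) ∧
        Tendsto PT atTop (𝓝 P)) ∧
      -- the optimal solution exists, is unique, and is given by the feedback `-Bᵀ P`
      (∀ ξ : EuclideanSpace ℝ (Fin n),
        (∃ (u : ℝ → EuclideanSpace ℝ (Fin p)) (x : ℝ → EuclideanSpace ℝ (Fin n)),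
          LQ.IsOptimal A B C (Ici 0) ξ u x) ∧
        (∀ (u u' : ℝ → EuclideanSpace ℝ (Fin p)) (x x' : ℝ → EuclideanSpace ℝ (Fin n)),
          LQ.IsOptimal A B C (Ici 0) ξ u x → LQ.IsOptimal A B C (Ici 0) ξ u' x' →
            u =ᵐ[volume.restrict (Ici 0)] u' ∧ EqOn x x' (Ici 0)) ∧
        (∀ (u : ℝ → EuclideanSpace ℝ (Fin p)) (x : ℝ → EuclideanSpace ℝ (Fin n)),
          LQ.IsOptimal A B C (Ici 0) ξ u x →
            ∀ᵐ t ∂(volume.restrict (Ici (0 : ℝ))), u t = -matAct Bᵀ (matAct P (x t)))) ∧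
      -- the algebraic Riccati equation
      Aᵀ * P + P * A - P * B * Bᵀ * P + Cᵀ * C = 0 := by
  obtain ⟨F, hF⟩ := LQ.exists_isMinSection_fibre hfin ordConnected_Ici self_mem_Ici le_rfl
  have hP := LQ.IsMinSection.isValueMatrix hF ordConnected_Ici self_mem_Ici le_rfl
  have hex : ∀ ξ, ∃ u x, LQ.IsOptimal A B C (Ici 0) ξ u x := fun ξ =>
    ⟨_, _, LQ.IsMinSection.isOptimal hF ξ⟩
  refine ⟨_, hP, fun Q hQ => hP.unique hQ, LQ.exists_tendsto_valueMatrix hfin hF,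
    fun ξ => ⟨hex ξ, fun u u' x x' h h' => ?_, fun u x h => hP.feedback hex h⟩,
    hP.riccati_eq_zero hex⟩
  obtain ⟨h1, h2⟩ := LQ.IsMinSection.isOptimal_unique hF h
  obtain ⟨h3, h4⟩ := LQ.IsMinSection.isOptimal_unique hF h'
  exact ⟨h1.trans h3.symm, h2.trans h4.symm⟩
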